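/- Let $\{|j\rangle\}_{j\in\mathbb Z_4}$ be the computational basis of $\mathbb C^4$, $X|j\rangle=|j+1 \bmod 4\rangle$, $Z|j\rangle=i^{j}|j\rangle$. The generalized Pauli matrices (GPMs) are $X^mZ^n$, $(m,n)\in\mathbb Z_4^2$; the generalized Bell states (GBSs) are $|\Phi_{m,n}\rangle=(I\otimes X^mZ^n)|\Phi\rangle$, where $|\Phi\rangle=\frac12\sum_{j}|jj\rangle$. A set of four GPMs (a 4-GPM set), or the corresponding set of four GBSs (a 4-GBS set), is identified with its set of labels $(m,n)$; it is called standard if it contains $I$, that is, the label $(0,0)$. Write $\approx$ for equality up to a phase factor. Two $n$-element sets of states $\{\phi_i\}$, $\{\psi_i\}$ in $\mathbb C^4\otimes\mathbb C^4$ are LU-equivalent if $\psi_i\approx(U_A\otimes U_B)\phi_{\sigma(i)}$ for all $i$, for some unitaries $U_A,U_B$ and some permutation $\sigma$. Two $n$-element sets of unitary matrices $\{M_i\}$, $\{N_i\}$ are U-equivalent if $N_i\approx LM_{\sigma(i)}R$ for all $i$, for some unitaries $L,R$ and some permutation $\sigma$; they are UC-equivalent if this holds with $R=L^\dagger$. Consider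 the ten standard 4-GPM sets \begin{align*} \mathcal K&=\{I,X^2,Z^2,X^2Z^2\},&\mathcal L&=\{I,X,X^2,X^3\},&\Gamma^1_{20}&=\{I,X,Z,X^2\},&\Gamma^1_{31}&=\{I,X,Z,X^3Z\},\\ \Gamma^1_{33}&=\{I,X,Z,X^3Z^3\},&\Gamma^2_{12}&=\{I,X,Z^2,XZ^2\},&\Gamma^2_{30}&=\{I,X,Z^2,X^3\},&\Gamma^1_{12}&=\{I,X,Z,XZ^2\},\\ \Gamma^2_{20}&=\{I,X,Z^2,X^2\},&\Gamma^2_{32}&=\{I,X,Z^2,X^3Z^2\}. \end{align*} For $\mathcal M=\{M_0,M_1,M_2,M_3\}$ among these, with elements in the order written, let $\mathcal M_i=\{M_jM_i^\dagger : 0\le j\le 3\}$, let $\mathcal{UC}(\mathcal M_i)$ be the set of all GPM sets UC-equivalent to $\mathcal M_i$, and let $\mathcal U(\mathcal M)$ be the set of all standard GPM sets U-equivalent to $\mathcal M$. Then: 1. The classes $\mathcal{UC}(\mathcal M_i)$ are exactly those in the following list, where $ab.ce.fg$ stands for the set with labels $\{(0,0),(a,b),(c,e),(f,g)\}$; within each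 item the sets are distinct, and their number is given. - $\mathcal{UC}((\mathcal K)_0)=\mathcal{UC}((\mathcal K)_1)=\mathcal{UC}((\mathcal K)_2)=\mathcal{UC}((\mathcal K)_3)$ (1 set): 02.20.22. - $\mathcal{UC}((\mathcal L)_0)=\mathcal{UC}((\mathcal L)_1)=\mathcal{UC}((\mathcal L)_2)=\mathcal{UC}((\mathcal L)_3)$ (6 sets): 01.02.03, 02.21.23, 10.20.30, 11.22.33, 12.20.32, 13.22.31. - $\mathcal{UC}((\Gamma^{1}_{20})_0)$ (48 sets): 01.02.30, 01.02.31, 01.02.32, 01.02.33, 01.10.20, 01.11.22, 01.12.20, 01.13.22, 02.03.10, 02.03.11, 02.03.12, 02.03.13, 02.10.23, 02.11.21, 02.12.23, 02.13.21, 02.21.30, 02.21.32, 02.23.31, 02.23.33, 03.20.30, 03.20.32, 03.22.31, 03.22.33, 10.11.20, 10.13.22, 10.20.21, 10.20.31, 10.22.33, 11.12.22, 11.20.32, 11.22.23, 11.22.30, 12.13.20, 12.20.21, 12.20.33, 12.22.31, 13.20.30, 13.22.23, 13.22.32, 20.23.30, 20.23.32, 20.30.33, 20.31.32, 21.22.31,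 21.22.33, 22.30.31, 22.32.33. - $\mathcal{UC}((\Gamma^{1}_{20})_1)$ (48 sets): 01.03.10, 01.03.11, 01.03.12, 01.03.13, 01.03.30, 01.03.31, 01.03.32, 01.03.33, 01.10.30, 01.11.33, 01.12.32, 01.13.31, 03.10.30, 03.11.33, 03.12.32, 03.13.31, 10.11.30, 10.11.33, 10.13.30, 10.13.31, 10.21.23, 10.21.30, 10.23.30, 10.30.31, 10.30.33, 11.12.32, 11.12.33, 11.21.23, 11.21.33, 11.23.33, 11.30.33, 11.32.33, 12.13.31, 12.13.32, 12.21.23, 12.21.32, 12.23.32, 12.31.32, 12.32.33, 13.21.23, 13.21.31, 13.23.31, 13.30.31, 13.31.32, 21.23.30, 21.23.31, 21.23.32, 21.23.33. - $\mathcal{UC}((\Gamma^{1}_{20})_2)$ (48 sets): 01.10.23, 01.10.32, 01.11.21, 01.11.31, 01.12.23, 01.12.30, 01.13.21, 01.13.33, 01.21.31, 01.21.33, 01.23.30, 01.23.32, 03.10.21, 03.10.32, 03.11.23, 03.11.31, 03.12.21, 03.12.30, 03.13.23, 03.13.33, 03.21.30, 03.21.32, 03.23.31, 03.23.33, 10.11.12,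 10.11.13, 10.12.13, 10.12.31, 10.12.33, 10.21.32, 10.23.32, 10.31.33, 11.12.13, 11.13.30, 11.13.32, 11.21.31, 11.23.31, 11.30.32, 12.21.30, 12.23.30, 12.31.33, 13.21.33, 13.23.33, 13.30.32, 30.31.32, 30.31.33, 30.32.33, 31.32.33. - $\mathcal{UC}((\Gamma^{1}_{20})_3)$ (48 sets): 01.02.10, 01.02.11, 01.02.12, 01.02.13, 01.20.30, 01.20.32, 01.22.31, 01.22.33, 02.03.30, 02.03.31, 02.03.32, 02.03.33, 02.10.21, 02.11.23, 02.12.21, 02.13.23, 02.21.31, 02.21.33, 02.23.30, 02.23.32, 03.10.20, 03.11.22, 03.12.20, 03.13.22, 10.11.22, 10.13.20, 10.20.23, 10.20.33, 10.22.31, 11.12.20, 11.20.30, 11.21.22, 11.22.32, 12.13.22, 12.20.23, 12.20.31, 12.22.33, 13.20.32, 13.21.22, 13.22.30, 20.21.30, 20.21.32, 20.30.31, 20.32.33, 22.23.31, 22.23.33, 22.30.33, 22.31.32. - $\mathcal{UC}((\Gamma^{1}_{31})_0)=\mathcal{UC}((\Gamma^{1}_{31})_1)=\mathcal{UC}((\Gamma^{1}_{31})_2)=\mathcal{UC}((\Gamma^{1}_{31})_3)$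 (48 sets): 01.10.11, 01.10.13, 01.10.31, 01.11.12, 01.11.30, 01.12.13, 01.12.33, 01.13.32, 01.30.31, 01.30.33, 01.31.32, 01.32.33, 03.10.11, 03.10.13, 03.10.33, 03.11.12, 03.11.32, 03.12.13, 03.12.31, 03.13.30, 03.30.31, 03.30.33, 03.31.32, 03.32.33, 10.11.21, 10.13.23, 10.21.31, 10.21.33, 10.23.31, 10.23.33, 11.12.23, 11.21.30, 11.21.32, 11.23.30, 11.23.32, 12.13.21, 12.21.31, 12.21.33, 12.23.31, 12.23.33, 13.21.30, 13.21.32, 13.23.30, 13.23.32, 21.30.31, 21.32.33, 23.30.33, 23.31.32. - $\mathcal{UC}((\Gamma^{1}_{33})_0)=\mathcal{UC}((\Gamma^{1}_{33})_1)=\mathcal{UC}((\Gamma^{1}_{33})_2)=\mathcal{UC}((\Gamma^{1}_{33})_3)$ (16 sets): 01.10.33, 01.11.32, 01.12.31, 01.13.30, 03.10.31, 03.11.30, 03.12.33, 03.13.32, 10.11.23, 10.13.21, 11.12.21, 12.13.23, 21.30.33, 21.31.32, 23.30.31, 23.32.33. - $\mathcal{UC}((\Gamma^{2}_{12})_0)=\mathcal{UC}((\Gamma^{2}_{12})_1)=\mathcal{UC}((\Gamma^{2}_{12})_2)=\mathcal{UC}((\Gamma^{2}_{12})_3)$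 (12 sets): 01.20.21, 01.22.23, 02.10.12, 02.11.13, 02.30.32, 02.31.33, 03.20.23, 03.21.22, 10.22.32, 11.20.31, 12.22.30, 13.20.33. - $\mathcal{UC}((\Gamma^{2}_{30})_0)=\mathcal{UC}((\Gamma^{2}_{30})_2)$ (12 sets): 01.03.20, 01.03.22, 02.10.30, 02.11.33, 02.12.32, 02.13.31, 10.22.30, 11.20.33, 12.22.32, 13.20.31, 20.21.23, 21.22.23. - $\mathcal{UC}((\Gamma^{2}_{30})_1)=\mathcal{UC}((\Gamma^{2}_{30})_3)$ (12 sets): 01.02.21, 01.02.23, 02.03.21, 02.03.23, 10.12.20, 10.20.32, 11.13.22, 11.22.31, 12.20.30, 13.22.33, 20.30.32, 22.31.33. - $\mathcal{UC}((\Gamma^{1}_{12})_0)$ (24 sets): 01.10.12, 01.11.13, 01.21.30, 01.21.32, 01.23.31, 01.23.33, 03.10.23, 03.11.21, 03.12.23, 03.13.21, 03.30.32, 03.31.33, 10.11.32, 10.12.21, 10.13.33, 10.31.32, 11.12.31, 11.13.23, 11.30.31, 12.13.30, 12.30.33, 13.32.33, 21.31.33, 23.30.32. - $\mathcal{UC}((\Gamma^{1}_{12})_1)=\mathcal{UC}((\Gamma^{1}_{12})_3)$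 (48 sets): 01.10.22, 01.11.20, 01.12.22, 01.13.20, 01.20.31, 01.20.33, 01.22.30, 01.22.32, 02.10.11, 02.10.13, 02.10.31, 02.10.33, 02.11.12, 02.11.30, 02.11.32, 02.12.13, 02.12.31, 02.12.33, 02.13.30, 02.13.32, 02.30.31, 02.30.33, 02.31.32, 02.32.33, 03.10.22, 03.11.20, 03.12.22, 03.13.20, 03.20.31, 03.20.33, 03.22.30, 03.22.32, 10.21.22, 10.22.23, 11.20.21, 11.20.23, 12.21.22, 12.22.23, 13.20.21, 13.20.23, 20.21.31, 20.21.33, 20.23.31, 20.23.33, 21.22.30, 21.22.32, 22.23.30, 22.23.32. - $\mathcal{UC}((\Gamma^{1}_{12})_2)$ (24 sets): 01.10.21, 01.11.23, 01.12.21, 01.13.23, 01.30.32, 01.31.33, 03.10.12, 03.11.13, 03.21.31, 03.21.33, 03.23.30, 03.23.32, 10.11.31, 10.12.23, 10.13.32, 10.32.33, 11.12.30, 11.13.21, 11.31.32, 12.13.33, 12.30.31, 13.30.33, 21.30.32, 23.31.33. - $\mathcal{UC}((\Gamma^{2}_{20})_0)=\mathcal{UC}((\Gamma^{2}_{20})_3)$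 (24 sets): 01.02.20, 01.02.22, 02.03.20, 02.03.22, 02.10.20, 02.11.22, 02.12.20, 02.13.22, 02.20.21, 02.20.23, 02.20.30, 02.20.32, 02.21.22, 02.22.23, 02.22.31, 02.22.33, 10.20.22, 11.20.22, 12.20.22, 13.20.22, 20.22.30, 20.22.31, 20.22.32, 20.22.33. - $\mathcal{UC}((\Gamma^{2}_{20})_1)$ (12 sets): 01.03.21, 01.03.23, 01.21.23, 03.21.23, 10.12.30, 10.12.32, 10.30.32, 11.13.31, 11.13.33, 11.31.33, 12.30.32, 13.31.33. - $\mathcal{UC}((\Gamma^{2}_{20})_2)$ (12 sets): 01.20.22, 02.10.22, 02.11.20, 02.12.22, 02.13.20, 02.20.31, 02.20.33, 02.22.30, 02.22.32, 03.20.22, 20.21.22, 20.22.23. - $\mathcal{UC}((\Gamma^{2}_{32})_0)=\mathcal{UC}((\Gamma^{2}_{32})_1)=\mathcal{UC}((\Gamma^{2}_{32})_2)=\mathcal{UC}((\Gamma^{2}_{32})_3)$ (12 sets): 01.20.23, 01.21.22, 02.10.32, 02.11.31, 02.12.30, 02.13.33, 03.20.21, 03.22.23, 10.12.22, 11.13.20,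 20.31.33, 22.30.32. 2. For each of the ten sets, $\mathcal U(\mathcal M)=\bigcup_{i=0}^{3}\mathcal{UC}(\mathcal M_i)$, so that $\mathcal U(\mathcal M)$ is the union of the items listed for $\mathcal M$. The numbers of elements of $\mathcal U(\mathcal K)$, $\mathcal U(\mathcal L)$, $\mathcal U(\Gamma^1_{20})$, $\mathcal U(\Gamma^1_{31})$, $\mathcal U(\Gamma^1_{33})$, $\mathcal U(\Gamma^2_{12})$, $\mathcal U(\Gamma^2_{30})$, $\mathcal U(\Gamma^1_{12})$, $\mathcal U(\Gamma^2_{20})$, $\mathcal U(\Gamma^2_{32})$ are $1$, $6$, $192$, $48$, $16$, $12$, $24$, $96$, $48$, $12$. 3. The ten GPM sets are pairwise not U-equivalent, and the ten corresponding GBS sets are pairwise not LU-equivalent. 4. Every 4-GBS set in $\mathbb C^4\otimes\mathbb C^4$ (standard or not) is LU-equivalent to exactly one of the ten GBS sets. -/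

import Mathlib

open scoped Matrix Kronecker

namespace GBS

noncomputable section

/-- Equality up to a global phase. -/
def PhaseEq {V : Type*} [SMul ℂ V] (a b : V) : Prop :=
  ∃ c : ℂ, ‖c‖ = 1 ∧ a = c • b

/-- `d × d` complex matrices, with rows and columns indexed by the computational basis
`|j⟩`, `j ∈ ℤ/d`. -/
abbrev Mat (d : ℕ) : Type := Matrix (ZMod d) (ZMod d) ℂ

/-- Vectors of `ℂ^d ⊗ ℂ^d` in coordinates with respect to the basis `|j⟩ ⊗ |k⟩`. -/
abbrev BiVec (d : ℕ) : Type := ZMod d × ZMod d → ℂ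

section Dim

variable (d : ℕ) [NeZero d]

/-- The shift `X |j⟩ = |j + 1 mod d⟩`. -/
def shiftX : Mat d := Matrix.of fun i j => if i = j + 1 then 1 else 0

/-- The clock `Z |j⟩ = ω ^ j |j⟩`, where `ω = exp (2 π i / d)`. -/
def clockZ : Mat d :=
  Matrix.diagonal fun j => Complex.exp (2 * Real.pi * Complex.I / d) ^ j.val

variable {d}

/-- The generalized Pauli matrix `X ^ m Z ^ n` with label `(m, n)`. -/
def gpm (p : ZMod d × ZMod d) : Mat d := shiftX d ^ p.1.val * clockZ d ^ p.2.val

variable (d) in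
/-- The canonical maximally entangled state `(1 / √d) ∑ j, |j⟩ ⊗ |j⟩`. -/
def maxEnt : BiVec d := fun x => if x.1 = x.2 then (1 / Real.sqrt d : ℂ) else 0

/-- The maximally entangled state `(I ⊗ U) |Φ⟩` of a unitary matrix `U`. -/
def mes (U : Mat d) : BiVec d := ((1 : Mat d) ⊗ₖ U) *ᵥ maxEnt d

/-- The generalized Bell state `(I ⊗ X ^ m Z ^ n) |Φ⟩`. -/
def gbs (p : ZMod d × ZMod d) : BiVec d := mes (gpm p)

/-- Local unitary equivalence of two sets of bipartite states, each given as a family of its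
members: `ψ i ≈ (U_A ⊗ U_B) φ (σ i)` for unitaries `U_A`, `U_B` and a bijection `σ`. -/
def LUEquiv {ι κ : Type*} (φ : ι → BiVec d) (ψ : κ → BiVec d) : Prop :=
  ∃ UA ∈ Matrix.unitaryGroup (ZMod d) ℂ, ∃ UB ∈ Matrix.unitaryGroup (ZMod d) ℂ,
    ∃ σ : κ ≃ ι, ∀ i, PhaseEq (ψ i) ((UA ⊗ₖ UB) *ᵥ φ (σ i))

/-- U-equivalence `L M R ≈ N` of two sets of matrices, each given as a family of its members. -/
def UEquiv {ι κ : Type*} (M : ι → Mat d) (N : κ → Mat d) : Prop :=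
  ∃ L ∈ Matrix.unitaryGroup (ZMod d) ℂ, ∃ R ∈ Matrix.unitaryGroup (ZMod d) ℂ,
    ∃ σ : κ ≃ ι, ∀ i, PhaseEq (N i) (L * M (σ i) * R)

/-- Unitary conjugate equivalence: U-equivalence with `R = L†`. -/
def UCEquiv {ι κ : Type*} (M : ι → Mat d) (N : κ → Mat d) : Prop :=
  ∃ L ∈ Matrix.unitaryGroup (ZMod d) ℂ,
    ∃ σ : κ ≃ ι, ∀ i, PhaseEq (N i) (L * M (σ i) * Lᴴ)

/-- The set of generalized Pauli matrices with labels in `S`, as a family of its members. -/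
def gpmSet (S : Finset (ZMod d × ZMod d)) : S → Mat d := fun p => gpm p.1

/-- The set of generalized Bell states with labels in `S`, as a family of its members. -/
def gbsSet (S : Finset (ZMod d × ZMod d)) : S → BiVec d := fun p => gbs p.1

/-- All GPM sets, given by their sets of labels, that are UC-equivalent to `M`. -/
def UCClass {ι : Type*} (M : ι → Mat d) : Set (Finset (ZMod d × ZMod d)) :=
  {N | UCEquiv M (gpmSet N)}

/-- All standard GPM sets (those that contain the identity, whose label is `(0, 0)`) that are
U-equivalent to `M`. -/
def UClass {ι : Type*} (M : ι → Mat d) : Set (Finset (ZMod d × ZMod d)) :=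
  {N | (0, 0) ∈ N ∧ UEquiv M (gpmSet N)}

/-- The set `M Mᵢ†`. -/
def rightDiv {ι : Type*} (M : ι → Mat d) (i : ι) : ι → Mat d := fun j => M j * (M i)ᴴ

end Dim

end

/-- Labels `(m, n)` of the generalized Pauli matrices on `ℂ^4`. -/
abbrev Label : Type := ZMod 4 × ZMod 4

/-- The labels of the ten representatives
`K`, `L`, `Γ¹₂₀`, `Γ¹₃₁`, `Γ¹₃₃`, `Γ²₁₂`, `Γ²₃₀`, `Γ¹₁₂`, `Γ²₂₀`, `Γ²₃₂`, in this order. -/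
def rep : Fin 10 → Fin 4 → Label :=
  ![![(0, 0), (2, 0), (0, 2), (2, 2)],
    ![(0, 0), (1, 0), (2, 0), (3, 0)],
    ![(0, 0), (1, 0), (0, 1), (2, 0)],
    ![(0, 0), (1, 0), (0, 1), (3, 1)],
    ![(0, 0), (1, 0), (0, 1), (3, 3)],
    ![(0, 0), (1, 0), (0, 2), (1, 2)],
    ![(0, 0), (1, 0), (0, 2), (3, 0)],
    ![(0, 0), (1, 0), (0, 1), (1, 2)],
    ![(0, 0), (1, 0), (0, 2), (2, 0)],
    ![(0, 0), (1, 0), (0, 2), (3, 2)]]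

/-- The representative GPM set with number `k`. -/
noncomputable def repGPM (k : Fin 10) : Fin 4 → Mat 4 := fun j => gpm (rep k j)

/-- The representative GBS set with number `k`. -/
noncomputable def repGBS (k : Fin 10) : Fin 4 → BiVec 4 := fun j => gbs (rep k j)

/-- The standard label set `{(0, 0), (a, b), (c, e), (f, g)}`. -/
def st (a b c e f g : ZMod 4) : Finset Label := {(0, 0), (a, b), (c, e), (f, g)}

/-- The listed class of the set `M M₀†` for `M = K` (1 items). -/
def ucK_0 : List (Finset Label) :=
  [st 0 2 2 0 2 2]

/-- The listed class of the set `M M₀†` for `M = L` (6 items). -/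
def ucL_0 : List (Finset Label) :=
  [st 0 1 0 2 0 3, st 0 2 2 1 2 3, st 1 0 2 0 3 0, st 1 1 2 2 3 3, st 1 2 2 0 3 2,
   st 1 3 2 2 3 1]

/-- The listed class of the set `M M₀†` for `M = Γ¹₂₀` (48 items). -/
def ucG120_0 : List (Finset Label) :=
  [st 0 1 0 2 3 0, st 0 1 0 2 3 1, st 0 1 0 2 3 2, st 0 1 0 2 3 3, st 0 1 1 0 2 0,
   st 0 1 1 1 2 2, st 0 1 1 2 2 0, st 0 1 1 3 2 2, st 0 2 0 3 1 0, st 0 2 0 3 1 1,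
   st 0 2 0 3 1 2, st 0 2 0 3 1 3, st 0 2 1 0 2 3, st 0 2 1 1 2 1, st 0 2 1 2 2 3,
   st 0 2 1 3 2 1, st 0 2 2 1 3 0, st 0 2 2 1 3 2, st 0 2 2 3 3 1, st 0 2 2 3 3 3,
   st 0 3 2 0 3 0, st 0 3 2 0 3 2, st 0 3 2 2 3 1, st 0 3 2 2 3 3, st 1 0 1 1 2 0,
   st 1 0 1 3 2 2, st 1 0 2 0 2 1, st 1 0 2 0 3 1, st 1 0 2 2 3 3, st 1 1 1 2 2 2,
   st 1 1 2 0 3 2, st 1 1 2 2 2 3, st 1 1 2 2 3 0, st 1 2 1 3 2 0, st 1 2 2 0 2 1,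
   st 1 2 2 0 3 3, st 1 2 2 2 3 1, st 1 3 2 0 3 0, st 1 3 2 2 2 3, st 1 3 2 2 3 2,
   st 2 0 2 3 3 0, st 2 0 2 3 3 2, st 2 0 3 0 3 3, st 2 0 3 1 3 2, st 2 1 2 2 3 1,
   st 2 1 2 2 3 3, st 2 2 3 0 3 1, st 2 2 3 2 3 3]

/-- The listed class of the set `M M₁†` for `M = Γ¹₂₀` (48 items). -/
def ucG120_1 : List (Finset Label) :=
  [st 0 1 0 3 1 0, st 0 1 0 3 1 1, st 0 1 0 3 1 2, st 0 1 0 3 1 3, st 0 1 0 3 3 0,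
   st 0 1 0 3 3 1, st 0 1 0 3 3 2, st 0 1 0 3 3 3, st 0 1 1 0 3 0, st 0 1 1 1 3 3,
   st 0 1 1 2 3 2, st 0 1 1 3 3 1, st 0 3 1 0 3 0, st 0 3 1 1 3 3, st 0 3 1 2 3 2,
   st 0 3 1 3 3 1, st 1 0 1 1 3 0, st 1 0 1 1 3 3, st 1 0 1 3 3 0, st 1 0 1 3 3 1,
   st 1 0 2 1 2 3, st 1 0 2 1 3 0, st 1 0 2 3 3 0, st 1 0 3 0 3 1, st 1 0 3 0 3 3,
   st 1 1 1 2 3 2, st 1 1 1 2 3 3, st 1 1 2 1 2 3, st 1 1 2 1 3 3, st 1 1 2 3 3 3,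
   st 1 1 3 0 3 3, st 1 1 3 2 3 3, st 1 2 1 3 3 1, st 1 2 1 3 3 2, st 1 2 2 1 2 3,
   st 1 2 2 1 3 2, st 1 2 2 3 3 2, st 1 2 3 1 3 2, st 1 2 3 2 3 3, st 1 3 2 1 2 3,
   st 1 3 2 1 3 1, st 1 3 2 3 3 1, st 1 3 3 0 3 1, st 1 3 3 1 3 2, st 2 1 2 3 3 0,
   st 2 1 2 3 3 1, st 2 1 2 3 3 2, st 2 1 2 3 3 3]

/-- The listed class of the set `M M₂†` for `M = Γ¹₂₀` (48 items). -/
def ucG120_2 : List (Finset Label) :=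
  [st 0 1 1 0 2 3, st 0 1 1 0 3 2, st 0 1 1 1 2 1, st 0 1 1 1 3 1, st 0 1 1 2 2 3,
   st 0 1 1 2 3 0, st 0 1 1 3 2 1, st 0 1 1 3 3 3, st 0 1 2 1 3 1, st 0 1 2 1 3 3,
   st 0 1 2 3 3 0, st 0 1 2 3 3 2, st 0 3 1 0 2 1, st 0 3 1 0 3 2, st 0 3 1 1 2 3,
   st 0 3 1 1 3 1, st 0 3 1 2 2 1, st 0 3 1 2 3 0, st 0 3 1 3 2 3, st 0 3 1 3 3 3,
   st 0 3 2 1 3 0, st 0 3 2 1 3 2, st 0 3 2 3 3 1, st 0 3 2 3 3 3, st 1 0 1 1 1 2,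
   st 1 0 1 1 1 3, st 1 0 1 2 1 3, st 1 0 1 2 3 1, st 1 0 1 2 3 3, st 1 0 2 1 3 2,
   st 1 0 2 3 3 2, st 1 0 3 1 3 3, st 1 1 1 2 1 3, st 1 1 1 3 3 0, st 1 1 1 3 3 2,
   st 1 1 2 1 3 1, st 1 1 2 3 3 1, st 1 1 3 0 3 2, st 1 2 2 1 3 0, st 1 2 2 3 3 0,
   st 1 2 3 1 3 3, st 1 3 2 1 3 3, st 1 3 2 3 3 3, st 1 3 3 0 3 2, st 3 0 3 1 3 2,
   st 3 0 3 1 3 3, st 3 0 3 2 3 3, st 3 1 3 2 3 3]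

/-- The listed class of the set `M M₃†` for `M = Γ¹₂₀` (48 items). -/
def ucG120_3 : List (Finset Label) :=
  [st 0 1 0 2 1 0, st 0 1 0 2 1 1, st 0 1 0 2 1 2, st 0 1 0 2 1 3, st 0 1 2 0 3 0,
   st 0 1 2 0 3 2, st 0 1 2 2 3 1, st 0 1 2 2 3 3, st 0 2 0 3 3 0, st 0 2 0 3 3 1,
   st 0 2 0 3 3 2, st 0 2 0 3 3 3, st 0 2 1 0 2 1, st 0 2 1 1 2 3, st 0 2 1 2 2 1,
   st 0 2 1 3 2 3, st 0 2 2 1 3 1, st 0 2 2 1 3 3, st 0 2 2 3 3 0, st 0 2 2 3 3 2,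
   st 0 3 1 0 2 0, st 0 3 1 1 2 2, st 0 3 1 2 2 0, st 0 3 1 3 2 2, st 1 0 1 1 2 2,
   st 1 0 1 3 2 0, st 1 0 2 0 2 3, st 1 0 2 0 3 3, st 1 0 2 2 3 1, st 1 1 1 2 2 0,
   st 1 1 2 0 3 0, st 1 1 2 1 2 2, st 1 1 2 2 3 2, st 1 2 1 3 2 2, st 1 2 2 0 2 3,
   st 1 2 2 0 3 1, st 1 2 2 2 3 3, st 1 3 2 0 3 2, st 1 3 2 1 2 2, st 1 3 2 2 3 0,
   st 2 0 2 1 3 0, st 2 0 2 1 3 2, st 2 0 3 0 3 1, st 2 0 3 2 3 3, st 2 2 2 3 3 1,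
   st 2 2 2 3 3 3, st 2 2 3 0 3 3, st 2 2 3 1 3 2]

/-- The listed class of the set `M M₀†` for `M = Γ¹₃₁` (48 items). -/
def ucG131_0 : List (Finset Label) :=
  [st 0 1 1 0 1 1, st 0 1 1 0 1 3, st 0 1 1 0 3 1, st 0 1 1 1 1 2, st 0 1 1 1 3 0,
   st 0 1 1 2 1 3, st 0 1 1 2 3 3, st 0 1 1 3 3 2, st 0 1 3 0 3 1, st 0 1 3 0 3 3,
   st 0 1 3 1 3 2, st 0 1 3 2 3 3, st 0 3 1 0 1 1, st 0 3 1 0 1 3, st 0 3 1 0 3 3,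
   st 0 3 1 1 1 2, st 0 3 1 1 3 2, st 0 3 1 2 1 3, st 0 3 1 2 3 1, st 0 3 1 3 3 0,
   st 0 3 3 0 3 1, st 0 3 3 0 3 3, st 0 3 3 1 3 2, st 0 3 3 2 3 3, st 1 0 1 1 2 1,
   st 1 0 1 3 2 3, st 1 0 2 1 3 1, st 1 0 2 1 3 3, st 1 0 2 3 3 1, st 1 0 2 3 3 3,
   st 1 1 1 2 2 3, st 1 1 2 1 3 0, st 1 1 2 1 3 2, st 1 1 2 3 3 0, st 1 1 2 3 3 2,
   st 1 2 1 3 2 1, st 1 2 2 1 3 1, st 1 2 2 1 3 3, st 1 2 2 3 3 1, st 1 2 2 3 3 3,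
   st 1 3 2 1 3 0, st 1 3 2 1 3 2, st 1 3 2 3 3 0, st 1 3 2 3 3 2, st 2 1 3 0 3 1,
   st 2 1 3 2 3 3, st 2 3 3 0 3 3, st 2 3 3 1 3 2]

/-- The listed class of the set `M M₀†` for `M = Γ¹₃₃` (16 items). -/
def ucG133_0 : List (Finset Label) :=
  [st 0 1 1 0 3 3, st 0 1 1 1 3 2, st 0 1 1 2 3 1, st 0 1 1 3 3 0, st 0 3 1 0 3 1,
   st 0 3 1 1 3 0, st 0 3 1 2 3 3, st 0 3 1 3 3 2, st 1 0 1 1 2 3, st 1 0 1 3 2 1,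
   st 1 1 1 2 2 1, st 1 2 1 3 2 3, st 2 1 3 0 3 3, st 2 1 3 1 3 2, st 2 3 3 0 3 1,
   st 2 3 3 2 3 3]

/-- The listed class of the set `M M₀†` for `M = Γ²₁₂` (12 items). -/
def ucG212_0 : List (Finset Label) :=
  [st 0 1 2 0 2 1, st 0 1 2 2 2 3, st 0 2 1 0 1 2, st 0 2 1 1 1 3, st 0 2 3 0 3 2,
   st 0 2 3 1 3 3, st 0 3 2 0 2 3, st 0 3 2 1 2 2, st 1 0 2 2 3 2, st 1 1 2 0 3 1,
   st 1 2 2 2 3 0, st 1 3 2 0 3 3]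

/-- The listed class of the set `M M₀†` for `M = Γ²₃₀` (12 items). -/
def ucG230_0 : List (Finset Label) :=
  [st 0 1 0 3 2 0, st 0 1 0 3 2 2, st 0 2 1 0 3 0, st 0 2 1 1 3 3, st 0 2 1 2 3 2,
   st 0 2 1 3 3 1, st 1 0 2 2 3 0, st 1 1 2 0 3 3, st 1 2 2 2 3 2, st 1 3 2 0 3 1,
   st 2 0 2 1 2 3, st 2 1 2 2 2 3]

/-- The listed class of the set `M M₁†` for `M = Γ²₃₀` (12 items). -/
def ucG230_1 : List (Finset Label) :=
  [st 0 1 0 2 2 1, st 0 1 0 2 2 3, st 0 2 0 3 2 1, st 0 2 0 3 2 3, st 1 0 1 2 2 0,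
   st 1 0 2 0 3 2, st 1 1 1 3 2 2, st 1 1 2 2 3 1, st 1 2 2 0 3 0, st 1 3 2 2 3 3,
   st 2 0 3 0 3 2, st 2 2 3 1 3 3]

/-- The listed class of the set `M M₀†` for `M = Γ¹₁₂` (24 items). -/
def ucG112_0 : List (Finset Label) :=
  [st 0 1 1 0 1 2, st 0 1 1 1 1 3, st 0 1 2 1 3 0, st 0 1 2 1 3 2, st 0 1 2 3 3 1,
   st 0 1 2 3 3 3, st 0 3 1 0 2 3, st 0 3 1 1 2 1, st 0 3 1 2 2 3, st 0 3 1 3 2 1,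
   st 0 3 3 0 3 2, st 0 3 3 1 3 3, st 1 0 1 1 3 2, st 1 0 1 2 2 1, st 1 0 1 3 3 3,
   st 1 0 3 1 3 2, st 1 1 1 2 3 1, st 1 1 1 3 2 3, st 1 1 3 0 3 1, st 1 2 1 3 3 0,
   st 1 2 3 0 3 3, st 1 3 3 2 3 3, st 2 1 3 1 3 3, st 2 3 3 0 3 2]

/-- The listed class of the set `M M₁†` for `M = Γ¹₁₂` (48 items). -/
def ucG112_1 : List (Finset Label) :=
  [st 0 1 1 0 2 2, st 0 1 1 1 2 0, st 0 1 1 2 2 2, st 0 1 1 3 2 0, st 0 1 2 0 3 1,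
   st 0 1 2 0 3 3, st 0 1 2 2 3 0, st 0 1 2 2 3 2, st 0 2 1 0 1 1, st 0 2 1 0 1 3,
   st 0 2 1 0 3 1, st 0 2 1 0 3 3, st 0 2 1 1 1 2, st 0 2 1 1 3 0, st 0 2 1 1 3 2,
   st 0 2 1 2 1 3, st 0 2 1 2 3 1, st 0 2 1 2 3 3, st 0 2 1 3 3 0, st 0 2 1 3 3 2,
   st 0 2 3 0 3 1, st 0 2 3 0 3 3, st 0 2 3 1 3 2, st 0 2 3 2 3 3, st 0 3 1 0 2 2,
   st 0 3 1 1 2 0, st 0 3 1 2 2 2, st 0 3 1 3 2 0, st 0 3 2 0 3 1, st 0 3 2 0 3 3,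
   st 0 3 2 2 3 0, st 0 3 2 2 3 2, st 1 0 2 1 2 2, st 1 0 2 2 2 3, st 1 1 2 0 2 1,
   st 1 1 2 0 2 3, st 1 2 2 1 2 2, st 1 2 2 2 2 3, st 1 3 2 0 2 1, st 1 3 2 0 2 3,
   st 2 0 2 1 3 1, st 2 0 2 1 3 3, st 2 0 2 3 3 1, st 2 0 2 3 3 3, st 2 1 2 2 3 0,
   st 2 1 2 2 3 2, st 2 2 2 3 3 0, st 2 2 2 3 3 2]

/-- The listed class of the set `M M₂†` for `M = Γ¹₁₂` (24 items). -/
def ucG112_2 : List (Finset Label) :=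
  [st 0 1 1 0 2 1, st 0 1 1 1 2 3, st 0 1 1 2 2 1, st 0 1 1 3 2 3, st 0 1 3 0 3 2,
   st 0 1 3 1 3 3, st 0 3 1 0 1 2, st 0 3 1 1 1 3, st 0 3 2 1 3 1, st 0 3 2 1 3 3,
   st 0 3 2 3 3 0, st 0 3 2 3 3 2, st 1 0 1 1 3 1, st 1 0 1 2 2 3, st 1 0 1 3 3 2,
   st 1 0 3 2 3 3, st 1 1 1 2 3 0, st 1 1 1 3 2 1, st 1 1 3 1 3 2, st 1 2 1 3 3 3,
   st 1 2 3 0 3 1, st 1 3 3 0 3 3, st 2 1 3 0 3 2, st 2 3 3 1 3 3]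

/-- The listed class of the set `M M₀†` for `M = Γ²₂₀` (24 items). -/
def ucG220_0 : List (Finset Label) :=
  [st 0 1 0 2 2 0, st 0 1 0 2 2 2, st 0 2 0 3 2 0, st 0 2 0 3 2 2, st 0 2 1 0 2 0,
   st 0 2 1 1 2 2, st 0 2 1 2 2 0, st 0 2 1 3 2 2, st 0 2 2 0 2 1, st 0 2 2 0 2 3,
   st 0 2 2 0 3 0, st 0 2 2 0 3 2, st 0 2 2 1 2 2, st 0 2 2 2 2 3, st 0 2 2 2 3 1,
   st 0 2 2 2 3 3, st 1 0 2 0 2 2, st 1 1 2 0 2 2, st 1 2 2 0 2 2, st 1 3 2 0 2 2,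
   st 2 0 2 2 3 0, st 2 0 2 2 3 1, st 2 0 2 2 3 2, st 2 0 2 2 3 3]

/-- The listed class of the set `M M₁†` for `M = Γ²₂₀` (12 items). -/
def ucG220_1 : List (Finset Label) :=
  [st 0 1 0 3 2 1, st 0 1 0 3 2 3, st 0 1 2 1 2 3, st 0 3 2 1 2 3, st 1 0 1 2 3 0,
   st 1 0 1 2 3 2, st 1 0 3 0 3 2, st 1 1 1 3 3 1, st 1 1 1 3 3 3, st 1 1 3 1 3 3,
   st 1 2 3 0 3 2, st 1 3 3 1 3 3]

/-- The listed class of the set `M M₂†` for `M = Γ²₂₀` (12 items). -/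
def ucG220_2 : List (Finset Label) :=
  [st 0 1 2 0 2 2, st 0 2 1 0 2 2, st 0 2 1 1 2 0, st 0 2 1 2 2 2, st 0 2 1 3 2 0,
   st 0 2 2 0 3 1, st 0 2 2 0 3 3, st 0 2 2 2 3 0, st 0 2 2 2 3 2, st 0 3 2 0 2 2,
   st 2 0 2 1 2 2, st 2 0 2 2 2 3]

/-- The listed class of the set `M M₀†` for `M = Γ²₃₂` (12 items). -/
def ucG232_0 : List (Finset Label) :=
  [st 0 1 2 0 2 3, st 0 1 2 1 2 2, st 0 2 1 0 3 2, st 0 2 1 1 3 1, st 0 2 1 2 3 0,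
   st 0 2 1 3 3 3, st 0 3 2 0 2 1, st 0 3 2 2 2 3, st 1 0 1 2 2 2, st 1 1 1 3 2 0,
   st 2 0 3 1 3 3, st 2 2 3 0 3 2]

/-- Row `k`, column `i`: the list of the GPM sets UC-equivalent to `M Mᵢ†`, where `M` is the
representative with number `k`. -/
def ucTable : Fin 10 → Fin 4 → List (Finset Label) :=
  ![![ucK_0, ucK_0, ucK_0, ucK_0],
    ![ucL_0, ucL_0, ucL_0, ucL_0],
    ![ucG120_0, ucG120_1, ucG120_2, ucG120_3],
    ![ucG131_0, ucG131_0, ucG131_0, ucG131_0],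
    ![ucG133_0, ucG133_0, ucG133_0, ucG133_0],
    ![ucG212_0, ucG212_0, ucG212_0, ucG212_0],
    ![ucG230_0, ucG230_1, ucG230_0, ucG230_1],
    ![ucG112_0, ucG112_1, ucG112_2, ucG112_1],
    ![ucG220_0, ucG220_1, ucG220_2, ucG220_0],
    ![ucG232_0, ucG232_0, ucG232_0, ucG232_0]]

/-- Entry `k`: the list of the standard GPM sets U-equivalent to the representative with
number `k`. -/
def uTable : Fin 10 → List (Finset Label) :=
  ![ucK_0,
    ucL_0,
    ucG120_0 ++ ucG120_1 ++ ucG120_2 ++ ucG120_3,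
    ucG131_0,
    ucG133_0,
    ucG212_0,
    ucG230_0 ++ ucG230_1,
    ucG112_0 ++ ucG112_1 ++ ucG112_2,
    ucG220_0 ++ ucG220_1 ++ ucG220_2,
    ucG232_0]

/-- The sizes of the ten U-equivalence classes of standard sets. -/
def classSize : Fin 10 → ℕ := ![1, 6, 192, 48, 16, 12, 24, 96, 48, 12]

/-- Row `k`, column `i`: the size of the UC-equivalence class of `M Mᵢ†`, where `M` is the
representative with number `k`. -/
def ucSize : Fin 10 → Fin 4 → ℕ :=
  ![![1, 1, 1, 1],
    ![6, 6, 6, 6],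
    ![48, 48, 48, 48],
    ![48, 48, 48, 48],
    ![16, 16, 16, 16],
    ![12, 12, 12, 12],
    ![12, 12, 12, 12],
    ![24, 48, 24, 48],
    ![24, 12, 12, 24],
    ![12, 12, 12, 12]]

end GBS

open scoped Matrix Kronecker

namespace GBS

open Matrix ZMod

/-! ### Phases and unitary matrices -/

section PhaseEq

/-! Vectorization turns `(U_A ⊗ U_B)` acting on the state of `M` into `U_B * M * U_Aᵀ`, so
LU-equivalence of Bell states is U-equivalence of their matrices (`luEquiv_mes_iff`). If a
U-equivalent image of `M` contains the identity, coming from `M i`, then `R` is `(M i)ᴴ * Lᴴ` up to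
phase; hence the U-class is the union of the UC-classes of the `M Mᵢ†` (`uClass_eq_iUnion`).

Each UC-class is computed from two sides. For `ucTable ⊆ UCClass`, the Fourier matrix and a diagonal
matrix of quadratic phases realize two generators of SL(2, ℤ/4) by conjugation, and words in them
reach every listed set. For the converse, a conjugating unitary need not be Clifford, but whenever
it sends Pauli matrices to Pauli matrices it preserves the symplectic form and all linear relations
of their labels (`ConjTo.symp_eq`, `ConjTo.eq_zero_iff`). In each `M Mᵢ†` one label is 0 and another
is a combination of the remaining two, so the images of those two determine the image set, and a
finite search over such pairs finds only listed sets (`exists_isFrame`).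

The representatives are inequivalent because none lies in the list of another. The ten lists are
then disjoint and have 455 = C(15, 3) members in total, so they exhaust the standard sets; any other
set becomes standard by a translation of labels. -/

theorem PhaseEq.refl {V : Type*} [MulAction ℂ V] (a : V) : PhaseEq a a :=
  ⟨1, by simp, by simp⟩

theorem PhaseEq.symm {V : Type*} [MulAction ℂ V] {a b : V} (h : PhaseEq a b) : PhaseEq b a := by
  obtain ⟨c, hc, rfl⟩ := h
  have hc0 : c ≠ 0 := by
    rintro rfl
    simp at hc
  exact ⟨c⁻¹, by simp [hc], by rw [smul_smul, inv_mul_cancel₀ hc0, one_smul]⟩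

theorem PhaseEq.trans {V : Type*} [MulAction ℂ V] {a b c : V} (h : PhaseEq a b)
    (h' : PhaseEq b c) : PhaseEq a c := by
  obtain ⟨x, hx, rfl⟩ := h
  obtain ⟨y, hy, rfl⟩ := h'
  exact ⟨x * y, by simp [hx, hy], by rw [smul_smul]⟩

theorem PhaseEq.mul {d : ℕ} [NeZero d] {A B A' B' : Mat d} (h : PhaseEq A B)
    (h' : PhaseEq A' B') : PhaseEq (A * A') (B * B') := by
  obtain ⟨x, hx, rfl⟩ := h
  obtain ⟨y, hy, rfl⟩ := h'
  exact ⟨x * y, by simp [hx, hy], by rw [smul_mul_smul_comm]⟩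

end PhaseEq

section Unitary

variable {d : ℕ} [NeZero d] {U : Mat d}

theorem mul_conjTranspose_of_mem (hU : U ∈ unitaryGroup (ZMod d) ℂ) : U * Uᴴ = 1 :=
  mem_unitaryGroup_iff.1 hU

theorem conjTranspose_mul_of_mem (hU : U ∈ unitaryGroup (ZMod d) ℂ) : Uᴴ * U = 1 :=
  mem_unitaryGroup_iff'.1 hU

theorem conjTranspose_mem (hU : U ∈ unitaryGroup (ZMod d) ℂ) : Uᴴ ∈ unitaryGroup (ZMod d) ℂ :=
  Unitary.star_mem hU

/-- Needed because a unitary on the first tensor factor acts on the matrix of a state as right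
multiplication by its transpose. -/
theorem transpose_mem (hU : U ∈ unitaryGroup (ZMod d) ℂ) : Uᵀ ∈ unitaryGroup (ZMod d) ℂ := by
  have h := congrArg transpose (conjTranspose_mul_of_mem hU)
  rw [transpose_mul, transpose_one] at h
  exact mem_unitaryGroup_iff.2 h

end Unitary

/-! ### U-equivalence, and the passage from states to matrices -/

section Equivalences

variable {d : ℕ} [NeZero d] {ι κ μ : Type*}

theorem UEquiv.symm {M : ι → Mat d} {N : κ → Mat d} (h : UEquiv M N) : UEquiv N M := by
  obtain ⟨L, hL, R, hR, σ, h⟩ := h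
  refine ⟨Lᴴ, conjTranspose_mem hL, Rᴴ, conjTranspose_mem hR, σ.symm, fun i => ?_⟩
  have h1 := ((PhaseEq.refl Lᴴ).mul (h (σ.symm i))).mul (PhaseEq.refl Rᴴ)
  have h2 : Lᴴ * (L * M i * R) * Rᴴ = (Lᴴ * L) * M i * (R * Rᴴ) := by simp only [Matrix.mul_assoc]
  rw [Equiv.apply_symm_apply, h2, conjTranspose_mul_of_mem hL, mul_conjTranspose_of_mem hR,
    Matrix.one_mul, Matrix.mul_one] at h1
  exact h1.symm

theorem UEquiv.trans {M : ι → Mat d} {N : κ → Mat d} {P : μ → Mat d} (h : UEquiv M N)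
    (h' : UEquiv N P) : UEquiv M P := by
  obtain ⟨L, hL, R, hR, σ, h⟩ := h
  obtain ⟨L', hL', R', hR', τ, h'⟩ := h'
  refine ⟨L' * L, mul_mem hL' hL, R * R', mul_mem hR hR', τ.trans σ, fun i => ?_⟩
  have h1 := (h' i).trans (((PhaseEq.refl L').mul (h (τ i))).mul (PhaseEq.refl R'))
  simpa only [Equiv.trans_apply, Matrix.mul_assoc] using h1

/-- Reindexing the families and changing phases preserves U-equivalence. -/
theorem UEquiv.of_phaseEq {M : ι → Mat d} {N : κ → Mat d} (σ : κ ≃ ι)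
    (h : ∀ i, PhaseEq (N i) (M (σ i))) : UEquiv M N :=
  ⟨1, one_mem _, 1, one_mem _, σ, fun i => by simpa using h i⟩

/-- The canonical state is the normalized vectorization of the identity, and `I ⊗ U` acts on
vectorizations by left multiplication. -/
theorem mes_eq (U : Mat d) : mes U = (1 / Real.sqrt d : ℂ) • vec U := by
  have h : maxEnt d = (1 / Real.sqrt d : ℂ) • vec (1 : Mat d) := by
    ext ⟨a, b⟩
    simp [maxEnt, vec, Matrix.one_apply, eq_comm]
  rw [mes, h, mulVec_smul, kronecker_mulVec_vec]
  simp

theorem kronecker_mulVec_mes (A B M : Mat d) : (A ⊗ₖ B) *ᵥ mes M = mes (B * M * Aᵀ) := by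
  rw [mes_eq, mes_eq, mulVec_smul, kronecker_mulVec_vec]

theorem phaseEq_mes_iff {M N : Mat d} : PhaseEq (mes M) (mes N) ↔ PhaseEq M N := by
  have hd : (1 / Real.sqrt d : ℂ) ≠ 0 := by
    simpa using NeZero.ne d
  refine exists_congr fun c => and_congr_right fun _ => ?_
  rw [mes_eq, mes_eq, smul_comm c, smul_right_inj hd, ← vec_smul, vec_inj]

/-- LU-equivalence of maximally entangled states is U-equivalence of their matrices. -/
theorem luEquiv_mes_iff {M : ι → Mat d} {N : κ → Mat d} :
    LUEquiv (fun i => mes (M i)) (fun i => mes (N i)) ↔ UEquiv M N := by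
  constructor
  · rintro ⟨A, hA, B, hB, σ, h⟩
    refine ⟨B, hB, Aᵀ, transpose_mem hA, σ, fun i => ?_⟩
    have := h i
    rwa [kronecker_mulVec_mes, phaseEq_mes_iff] at this
  · rintro ⟨L, hL, R, hR, σ, h⟩
    refine ⟨Rᵀ, transpose_mem hR, L, hL, σ, fun i => ?_⟩
    rw [kronecker_mulVec_mes, phaseEq_mes_iff, transpose_transpose]
    exact h i

end Equivalences

/-! ### Multiplication and commutation of generalized Pauli matrices -/

section Pauli

variable {d : ℕ} [NeZero d]

theorem shiftX_pow_apply (k : ℕ) (i j : ZMod d) :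
    (shiftX d ^ k) i j = if i = j + k then 1 else 0 := by
  induction k generalizing i j with
  | zero => simp [Matrix.one_apply]
  | succ k ih =>
    rw [pow_succ, Matrix.mul_apply, Finset.sum_eq_single (j + 1)]
    · rw [ih, shiftX, Matrix.of_apply, if_pos rfl, mul_one]
      congr 2
      push_cast
      ring
    · intro b _ hb
      simp [shiftX, hb]
    · simp

theorem exp_pow_val (j : ZMod d) :
    Complex.exp (2 * Real.pi * Complex.I / d) ^ j.val = stdAddChar j := by
  have h := stdAddChar_coe (N := d) (j.val : ℤ)
  rw [← Complex.exp_nat_mul]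
  simp only [Int.cast_natCast, natCast_zmod_val] at h
  rw [h]
  congr 1
  ring

/-- Writing the powers of ω through `stdAddChar` makes the exponents elements of `ZMod d`, so phase
identities reduce to `ring`. -/
theorem gpm_apply (p : ZMod d × ZMod d) (i j : ZMod d) :
    gpm p i j = if i = j + p.1 then stdAddChar (p.2 * j) else 0 := by
  rw [gpm, clockZ, diagonal_pow, mul_diagonal, shiftX_pow_apply, natCast_zmod_val, Pi.pow_apply,
    exp_pow_val, ← AddChar.map_nsmul_eq_pow, nsmul_eq_mul, natCast_zmod_val]
  simp

theorem norm_stdAddChar (j : ZMod d) : ‖(stdAddChar j : ℂ)‖ = 1 := by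
  rw [stdAddChar_apply, Circle.norm_coe]

theorem gpm_zero : gpm (0 : ZMod d × ZMod d) = 1 := by
  ext i j
  simp [gpm_apply, Matrix.one_apply]

theorem gpm_mul (p q : ZMod d × ZMod d) :
    gpm p * gpm q = (stdAddChar (p.2 * q.1) : ℂ) • gpm (p + q) := by
  ext i j
  rw [Matrix.mul_apply, Finset.sum_eq_single (j + q.1)]
  · simp only [gpm_apply, if_true, Matrix.smul_apply, smul_eq_mul, Prod.fst_add, Prod.snd_add]
    have h : j + (p.1 + q.1) = j + q.1 + p.1 := by ring
    rw [h]
    split_ifs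
    · rw [← AddChar.map_add_eq_mul, ← AddChar.map_add_eq_mul]
      congr 1
      ring
    · simp
  · intro b _ hb
    simp [gpm_apply q, hb]
  · simp

theorem gpm_mul_phaseEq (p q : ZMod d × ZMod d) : PhaseEq (gpm (p + q)) (gpm p * gpm q) :=
  PhaseEq.symm ⟨_, norm_stdAddChar _, gpm_mul p q⟩

theorem gpm_mem (p : ZMod d × ZMod d) : gpm p ∈ unitaryGroup (ZMod d) ℂ := by
  have hs : shiftX d ∈ unitaryGroup (ZMod d) ℂ := by
    rw [mem_unitaryGroup_iff]
    ext i j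
    rw [Matrix.mul_apply, Finset.sum_eq_single (j - 1)]
    · simp [shiftX, Matrix.star_apply, Matrix.one_apply]
    · intro b _ hb
      have : ¬ j = b + 1 := fun h => hb (by rw [h]; ring)
      simp [shiftX, Matrix.star_apply, this]
    · simp
  have hz : clockZ d ∈ unitaryGroup (ZMod d) ℂ := by
    rw [mem_unitaryGroup_iff, clockZ, star_eq_conjTranspose, diagonal_conjTranspose,
      diagonal_mul_diagonal, ← diagonal_one]
    congr 1
    ext j
    rw [Pi.star_apply, exp_pow_val]
    simp [Complex.mul_conj, Complex.normSq_eq_norm_sq]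
  exact mul_mem (pow_mem hs _) (pow_mem hz _)

theorem gpm_ne_zero (p : ZMod d × ZMod d) : gpm p ≠ 0 := by
  intro h
  have := mul_conjTranspose_of_mem (gpm_mem p)
  simp [h] at this

theorem gpm_injective_phaseEq {p q : ZMod d × ZMod d} (h : PhaseEq (gpm p) (gpm q)) : p = q := by
  obtain ⟨c, hc, h⟩ := h
  -- The nonzero entry of column 0 gives equal shifts and forces the phase to be 1; the nonzero
  -- entry of column 1 then gives equal clock exponents.
  have h0 := congrFun (congrFun h p.1) 0
  have h1 := congrFun (congrFun h (1 + p.1)) 1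
  simp only [gpm_apply, Matrix.smul_apply, smul_eq_mul, zero_add, if_true, mul_zero,
    AddChar.map_zero_eq_one, mul_one] at h0 h1
  have hpq : p.1 = q.1 := by
    by_contra hne
    simp [hne] at h0
  rw [if_pos hpq, mul_one] at h0
  rw [if_pos (by rw [hpq]), ← h0, one_mul] at h1
  exact Prod.ext hpq (injective_stdAddChar h1)

theorem gpm_conjTranspose_phaseEq (p : ZMod d × ZMod d) : PhaseEq (gpm (-p)) (gpm p)ᴴ := by
  have h := (gpm_mul_phaseEq (-p) p).mul (PhaseEq.refl (gpm p)ᴴ)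
  rw [neg_add_cancel, gpm_zero, Matrix.one_mul, Matrix.mul_assoc,
    mul_conjTranspose_of_mem (gpm_mem p), Matrix.mul_one] at h
  exact h.symm

theorem gpm_mul_conjTranspose_phaseEq (p q : ZMod d × ZMod d) :
    PhaseEq (gpm p * (gpm q)ᴴ) (gpm (p - q)) := by
  rw [sub_eq_add_neg]
  exact ((gpm_mul_phaseEq p (-q)).trans
    ((PhaseEq.refl _).mul (gpm_conjTranspose_phaseEq q))).symm

/-- The symplectic form on labels. -/
def symp (p q : ZMod d × ZMod d) : ZMod d := p.2 * q.1 - q.2 * p.1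

theorem gpm_mul_comm (p q : ZMod d × ZMod d) :
    gpm p * gpm q = (stdAddChar (symp p q) : ℂ) • (gpm q * gpm p) := by
  rw [gpm_mul, gpm_mul, smul_smul, ← AddChar.map_add_eq_mul, add_comm q p]
  congr 2
  rw [symp]
  ring

end Pauli

/-! ### Conjugation as a relation between labels -/

section Conj

variable {d : ℕ} [NeZero d]

/-- Conjugation by `U` maps the generalized Pauli matrix with label `p` to the one with label
`q`, up to a phase. -/
def ConjTo (U : Mat d) (p q : ZMod d × ZMod d) : Prop := PhaseEq (gpm q) (U * gpm p * Uᴴ)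

variable {U : Mat d} {p q p' q' : ZMod d × ZMod d}

theorem conj_mul_conj (hU : U ∈ unitaryGroup (ZMod d) ℂ) (A B : Mat d) :
    (U * A * Uᴴ) * (U * B * Uᴴ) = U * (A * B) * Uᴴ := by
  calc (U * A * Uᴴ) * (U * B * Uᴴ) = U * A * (Uᴴ * U) * B * Uᴴ := by simp only [Matrix.mul_assoc]
    _ = _ := by rw [conjTranspose_mul_of_mem hU, Matrix.mul_one]; simp only [Matrix.mul_assoc]

theorem conjTranspose_conj (hU : U ∈ unitaryGroup (ZMod d) ℂ) (A : Mat d) :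
    Uᴴ * (U * A * Uᴴ) * U = A := by
  calc Uᴴ * (U * A * Uᴴ) * U = (Uᴴ * U) * A * (Uᴴ * U) := by simp only [Matrix.mul_assoc]
    _ = _ := by rw [conjTranspose_mul_of_mem hU, Matrix.mul_one, Matrix.one_mul]

theorem ConjTo.zero (hU : U ∈ unitaryGroup (ZMod d) ℂ) : ConjTo U 0 0 := by
  rw [ConjTo, gpm_zero, Matrix.mul_one, mul_conjTranspose_of_mem hU]
  exact PhaseEq.refl _

theorem ConjTo.add (hU : U ∈ unitaryGroup (ZMod d) ℂ) (h : ConjTo U p q) (h' : ConjTo U p' q') :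
    ConjTo U (p + p') (q + q') := by
  have h1 := h.mul h'
  rw [conj_mul_conj hU] at h1
  exact ((gpm_mul_phaseEq q q').trans h1).trans
    (((PhaseEq.refl U).mul (gpm_mul_phaseEq p p').symm).mul (PhaseEq.refl Uᴴ))

theorem ConjTo.nsmul (hU : U ∈ unitaryGroup (ZMod d) ℂ) (h : ConjTo U p q) (n : ℕ) :
    ConjTo U (n • p) (n • q) := by
  induction n with
  | zero => simpa using ConjTo.zero hU
  | succ n ih => simpa only [succ_nsmul] using ih.add hU h

theorem ConjTo.smul (hU : U ∈ unitaryGroup (ZMod d) ℂ) (h : ConjTo U p q) (a : ZMod d) :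
    ConjTo U (a • p) (a • q) := by
  have := h.nsmul hU a.val
  rwa [← Nat.cast_smul_eq_nsmul (ZMod d), ← Nat.cast_smul_eq_nsmul (ZMod d),
    natCast_zmod_val] at this

theorem ConjTo.right_unique (h : ConjTo U p q) (h' : ConjTo U p q') : q = q' :=
  gpm_injective_phaseEq (h.trans (PhaseEq.symm h'))

theorem ConjTo.symm (hU : U ∈ unitaryGroup (ZMod d) ℂ) (h : ConjTo U p q) : ConjTo Uᴴ q p := by
  have h1 := ((PhaseEq.refl Uᴴ).mul h).mul (PhaseEq.refl U)
  rw [conjTranspose_conj hU] at h1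
  rw [ConjTo, conjTranspose_conjTranspose]
  exact h1.symm

theorem ConjTo.eq_zero_iff (hU : U ∈ unitaryGroup (ZMod d) ℂ) (h : ConjTo U p q) :
    p = 0 ↔ q = 0 := by
  constructor
  · rintro rfl
    exact h.right_unique (ConjTo.zero hU)
  · rintro rfl
    exact (h.symm hU).right_unique (ConjTo.zero (conjTranspose_mem hU))

/-- The scalar by which two matrices fail to commute survives conjugation and rephasing. For Pauli
matrices it is the value at the symplectic product of a character that is injective on `ZMod d`. -/
theorem ConjTo.symp_eq (hU : U ∈ unitaryGroup (ZMod d) ℂ) (h : ConjTo U p q)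
    (h' : ConjTo U p' q') : symp p p' = symp q q' := by
  obtain ⟨x, hx, h⟩ := h
  obtain ⟨y, hy, h'⟩ := h'
  have h1 : gpm q * gpm q' = (stdAddChar (symp p p') : ℂ) • (gpm q' * gpm q) := by
    rw [h, h', smul_mul_smul_comm, smul_mul_smul_comm, conj_mul_conj hU, conj_mul_conj hU,
      gpm_mul_comm p p', Matrix.mul_smul, Matrix.smul_mul, smul_smul, smul_smul]
    congr 1
    ring
  rw [gpm_mul_comm q q', gpm_mul] at h1
  rw [smul_smul, smul_smul] at h1
  have h2 := smul_left_injective ℂ (gpm_ne_zero (q' + q)) h1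
  have h3 : (stdAddChar (q'.2 * q.1) : ℂ) ≠ 0 := by
    intro h0
    have := norm_stdAddChar (q'.2 * q.1)
    simp [h0] at this
  exact (injective_stdAddChar (mul_right_cancel₀ h3 h2)).symm

/-- A map of labels that is induced by conjugation with a unitary matrix. -/
def IsClifford (f : ZMod d × ZMod d → ZMod d × ZMod d) : Prop :=
  ∃ U ∈ unitaryGroup (ZMod d) ℂ, ∀ p, ConjTo U p (f p)

theorem IsClifford.id : IsClifford (d := d) id :=
  ⟨1, one_mem _, fun p => by simpa [ConjTo] using PhaseEq.refl (gpm p)⟩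

theorem IsClifford.comp {f g : ZMod d × ZMod d → ZMod d × ZMod d} (hf : IsClifford f)
    (hg : IsClifford g) : IsClifford (f ∘ g) := by
  obtain ⟨U, hU, hf⟩ := hf
  obtain ⟨V, hV, hg⟩ := hg
  refine ⟨U * V, mul_mem hU hV, fun p => ?_⟩
  have h := (hf (g p)).trans (((PhaseEq.refl U).mul (hg p)).mul (PhaseEq.refl Uᴴ))
  simpa only [ConjTo, Function.comp, conjTranspose_mul, Matrix.mul_assoc] using h

theorem IsClifford.injective {f : ZMod d × ZMod d → ZMod d × ZMod d} (hf : IsClifford f) :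
    Function.Injective f := by
  obtain ⟨U, hU, hf⟩ := hf
  intro p q hpq
  have h := (hf p).symm hU
  rw [hpq] at h
  exact h.right_unique ((hf q).symm hU)

theorem conjTo_of_mul_eq (hU : U ∈ unitaryGroup (ZMod d) ℂ)
    (h : PhaseEq (gpm q * U) (U * gpm p)) : ConjTo U p q := by
  have h1 := h.mul (PhaseEq.refl Uᴴ)
  rwa [Matrix.mul_assoc, mul_conjTranspose_of_mem hU, Matrix.mul_one] at h1

/-- The discrete Fourier transform acts by `(m, n) ↦ (-n, m)`. -/
theorem isClifford_fourier : IsClifford (d := d) fun p => (-p.2, p.1) := by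
  set F : Mat d := Matrix.of fun j k => (1 / Real.sqrt d : ℂ) * stdAddChar (j * k) with hF
  have hd : ((Real.sqrt d : ℝ) : ℂ) * (Real.sqrt d : ℝ) = d := by
    rw [← Complex.ofReal_mul, Real.mul_self_sqrt (Nat.cast_nonneg d)]
    simp
  have hd0 : (d : ℂ) ≠ 0 := by simpa using NeZero.ne d
  have hFU : F ∈ unitaryGroup (ZMod d) ℂ := by
    rw [mem_unitaryGroup_iff]
    ext i j
    have hterm : ∀ k, F i k * (star F) k j = (1 / d : ℂ) * stdAddChar (k * (i - j)) := by
      intro k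
      have hs : star (stdAddChar (j * k) : ℂ) = stdAddChar (-(j * k)) := by
        rw [AddChar.map_neg_eq_conj]; rfl
      simp only [hF, Matrix.star_apply, Matrix.of_apply, star_mul', hs]
      have : star (1 / (Real.sqrt d : ℝ) : ℂ) = 1 / (Real.sqrt d : ℝ) := by simp
      rw [this, mul_mul_mul_comm, ← AddChar.map_add_eq_mul, div_mul_div_comm, hd, one_mul]
      congr 2
      ring
    -- Orthogonality of characters: the sum over `k` vanishes unless `i = j`.
    rw [Matrix.mul_apply, Finset.sum_congr rfl fun k _ => hterm k, ← Finset.mul_sum,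
      AddChar.sum_mulShift _ (isPrimitive_stdAddChar d), ZMod.card, Matrix.one_apply]
    simp only [sub_eq_zero]
    split_ifs
    · simp [hd0]
    · simp
  -- The phase `stdAddChar (p.1 * p.2)` comes from the row `k + p.2` at which the clock factor is
  -- evaluated.
  refine ⟨F, hFU, fun p => conjTo_of_mul_eq hFU ⟨stdAddChar (p.1 * p.2), norm_stdAddChar _, ?_⟩⟩
  ext k j
  rw [Matrix.smul_apply, Matrix.mul_apply, Matrix.mul_apply, Finset.sum_eq_single (k + p.2),
    Finset.sum_eq_single (j + p.1)]
  · simp only [gpm_apply, hF, Matrix.of_apply, add_neg_cancel_right, if_true, smul_eq_mul]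
    rw [mul_left_comm, ← AddChar.map_add_eq_mul, mul_assoc, mul_left_comm,
      ← AddChar.map_add_eq_mul, ← AddChar.map_add_eq_mul]
    congr 2
    ring
  · intro b _ hb
    simp [gpm_apply, hb]
  · simp
  · intro b _ hb
    have : ¬ k = b + -p.2 := fun h => hb (by rw [h]; ring)
    simp [gpm_apply, this]
  · simp

/-- A diagonal matrix with quadratic phases acts by `(m, n) ↦ (m, n + m)`. -/
theorem isClifford_of_quadratic (f : ZMod d → ℂ) (hf : ∀ j, ‖f j‖ = 1)
    (hq : ∀ j m, f (j + m) = f m * stdAddChar (m * j) * f j) :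
    IsClifford (d := d) fun p => (p.1, p.2 + p.1) := by
  have hU : diagonal f ∈ unitaryGroup (ZMod d) ℂ := by
    rw [mem_unitaryGroup_iff, star_eq_conjTranspose, diagonal_conjTranspose,
      diagonal_mul_diagonal, ← diagonal_one]
    congr 1
    ext j
    simp [Complex.mul_conj, Complex.normSq_eq_norm_sq, hf]
  refine ⟨diagonal f, hU, fun p => conjTo_of_mul_eq hU (PhaseEq.symm ⟨f p.1, hf _, ?_⟩)⟩
  ext i j
  rw [diagonal_mul, Matrix.smul_apply, mul_diagonal]
  simp only [gpm_apply, smul_eq_mul]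
  split_ifs with h
  · rw [h, hq, add_mul, AddChar.map_add_eq_mul]
    ring
  · simp

end Conj

/-! ### Clifford maps in dimension four -/

section Four

/-- The label map of the discrete Fourier transform. -/
def fourierMap (p : Label) : Label := (-p.2, p.1)

/-- The label map of the diagonal matrix with quadratic phases. -/
def phaseMap (p : Label) : Label := (p.1, p.2 + p.1)

/-- Quadratic phases in even dimension need a root of unity of order `2 * d`: with ζ of order 8, `ζ
^ (j ^ 2)` depends only on `j` mod 4, since squares of integers congruent mod 4 agree mod 8. -/
theorem isClifford_phaseMap : IsClifford phaseMap := by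
  set ζ : ℂ := Complex.exp (Real.pi * Complex.I / 4) with hζ
  have h8 : ζ ^ 8 = 1 := by
    rw [hζ, ← Complex.exp_nat_mul, ← Complex.exp_two_pi_mul_I]
    congr 1
    push_cast
    ring
  have hχ : ∀ x : ZMod 4, (stdAddChar x : ℂ) = ζ ^ (2 * x.val) := by
    intro x
    rw [← exp_pow_val, pow_mul, hζ, ← Complex.exp_nat_mul _ 2]
    congr 2
    push_cast
    ring
  refine isClifford_of_quadratic (fun j => ζ ^ (j.val ^ 2)) (fun j => ?_) fun j m => ?_
  · rw [norm_pow, Complex.norm_eq_one_of_pow_eq_one h8 (by norm_num), one_pow]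
  -- The expansion of `(j + m) ^ 2`, with every residue replaced by its representative in `0, …, 3`.
  · have hmod : ∀ j m : ZMod 4, (j + m).val ^ 2 % 8
        = (m.val ^ 2 + 2 * (m * j).val + j.val ^ 2) % 8 := by decide
    rw [hχ, ← pow_add, ← pow_add, pow_eq_pow_mod _ h8, hmod, ← pow_eq_pow_mod _ h8]

theorem IsClifford.iterate {f : Label → Label} (hf : IsClifford f) (n : ℕ) :
    IsClifford f^[n] := by
  induction n with
  | zero => exact IsClifford.id
  | succ n ih => exact ih.comp hf

/-- Every element of `SL(2, ℤ/4)` has this form in the two generators. -/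
def word (a b c : ℕ) (p : Label) : Label :=
  fourierMap^[a] (phaseMap^[b] (fourierMap (phaseMap^[c] p)))

theorem isClifford_word (a b c : ℕ) : IsClifford (word a b c) :=
  ((isClifford_fourier (d := 4)).iterate a).comp ((isClifford_phaseMap.iterate b).comp
    ((isClifford_fourier (d := 4)).comp (isClifford_phaseMap.iterate c)))

/-- The label of `M Mᵢ†` with number `j`, where `M` is the representative with number `k`. -/
def tr (k : Fin 10) (i j : Fin 4) : Label := rep k j - rep k i

end Four

/-! ### Translation of label arithmetic into natural numbers -/

section Code

/-- Numbering of the labels by `0, …, 15`, which makes the finite checks below cheap. -/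
def code (p : Label) : ℕ := 4 * p.1.val + p.2.val

/-- Binary encoding of a set of labels. -/
def mask (S : Finset Label) : ℕ := ∑ p ∈ S, 2 ^ code p

/-- The reduction after `4 - x % 4` only serves to turn 4 into 0. -/
def fourierCode (x : ℕ) : ℕ := 4 * ((4 - x % 4) % 4) + x / 4

def phaseCode (x : ℕ) : ℕ := 4 * (x / 4) + (x % 4 + x / 4) % 4

def wordCode (a b c x : ℕ) : ℕ :=
  fourierCode^[a] (phaseCode^[b] (fourierCode (phaseCode^[c] x)))

/-- The code of `α p + β q` for labels `p`, `q` with codes `x`, `y`. -/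
def combCode (α β x y : ℕ) : ℕ :=
  4 * ((α * (x / 4) + β * (y / 4)) % 4) + (α * (x % 4) + β * (y % 4)) % 4

/-- The factor 3 stands for -1 mod 4 and avoids truncated subtraction. -/
def sympCode (x y : ℕ) : ℕ := (x % 4 * (y / 4) + 3 * (y % 4 * (x / 4))) % 4

theorem code_lt (p : Label) : code p < 16 := by
  have h1 := p.1.val_lt
  have h2 := p.2.val_lt
  unfold code
  omega

theorem code_div (p : Label) : code p / 4 = p.1.val := by
  have h2 := p.2.val_lt
  unfold code
  omega

theorem code_mod (p : Label) : code p % 4 = p.2.val := by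
  have h2 := p.2.val_lt
  unfold code
  omega

theorem code_injective : Function.Injective code := fun p q h =>
  Prod.ext (val_injective 4 (by rw [← code_div, h, code_div]))
    (val_injective 4 (by rw [← code_mod, h, code_mod]))

theorem code_fourierMap (p : Label) : code (fourierMap p) = fourierCode (code p) := by
  have h : ∀ x : ZMod 4, (-x).val = (4 - x.val) % 4 := by decide
  rw [fourierCode, code_div, code_mod, ← h]
  rfl

theorem code_phaseMap (p : Label) : code (phaseMap p) = phaseCode (code p) := by
  rw [phaseCode, code_div, code_mod, ← val_add]
  rfl

theorem code_word (a b c : ℕ) (p : Label) : code (word a b c p) = wordCode a b c (code p) := by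
  have hf : ∀ n, Function.Semiconj code fourierMap^[n] fourierCode^[n] := fun n =>
    Function.Semiconj.iterate_right code_fourierMap n
  have hp : ∀ n, Function.Semiconj code phaseMap^[n] phaseCode^[n] := fun n =>
    Function.Semiconj.iterate_right code_phaseMap n
  rw [word, wordCode, hf a, hp b, code_fourierMap, hp c]

theorem code_comb (α β : ℕ) (p q : Label) :
    code ((α : ZMod 4) • p + (β : ZMod 4) • q) = combCode α β (code p) (code q) := by
  have h : ∀ x y : ZMod 4, ((α : ZMod 4) * x + (β : ZMod 4) * y).val
      = (α * x.val + β * y.val) % 4 := by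
    intro x y
    rw [← val_natCast]
    push_cast
    simp
  rw [combCode, code_div, code_mod, code_div, code_mod, ← h, ← h]
  rfl

theorem symp_val (p q : Label) : (symp p q).val = sympCode (code p) (code q) := by
  rw [sympCode, code_div, code_mod, code_div, code_mod, ← val_natCast]
  congr 1
  have h3 : (3 : ZMod 4) = -1 := by decide
  push_cast
  simp only [natCast_val, cast_id', id, symp, h3]
  ring

/-- Uniqueness of binary expansions, as distinct labels have distinct codes. -/
theorem mask_injective : Function.Injective mask := by
  intro S T h
  have hm : ∀ S : Finset Label, mask S = ∑ n ∈ S.image code, 2 ^ n := fun S =>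
    (Finset.sum_image code_injective.injOn).symm
  rw [hm, hm] at h
  exact Finset.image_injective code_injective (Finset.geomSum_injective le_rfl h)

theorem mask_image {q : Fin 4 → Label} (hq : Function.Injective q) :
    mask (Finset.univ.image q) = ∑ j, 2 ^ code (q j) :=
  Finset.sum_image hq.injOn

/-- The pairs of labels with codes `x`, `y` and `x'`, `y'` have the same symplectic product and
the same linear relations. -/
def SameRelations (x y x' y' : ℕ) : Prop :=
  sympCode x y = sympCode x' y' ∧
    ∀ a < 4, ∀ b < 4, (combCode a b x y = 0 ↔ combCode a b x' y' = 0)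

instance (x y x' y' : ℕ) : Decidable (SameRelations x y x' y') :=
  inferInstanceAs (Decidable (_ ∧ _))

end Code

/-! ### Finite checks -/

section Checks

set_option maxRecDepth 10000

/-- The computational half of `ucTable ⊆ UCClass`; the bounds leave 64 words to try. -/
theorem exists_word_of_mem_ucTable : ∀ (k : Fin 10) (i : Fin 4), ∀ n ∈ (ucTable k i).map mask,
    ∃ a < 4, ∃ b < 4, ∃ c < 4, n = ∑ j, 2 ^ wordCode a b c (code (tr k i j)) := by
  decide +kernel

/-- The last of the four labels of `M Mᵢ†` is the combination of two others with
coefficients `α`, `β`, and every pair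
with the same relations as these two gives a listed set. -/
def IsFrame (k : Fin 10) (i u v w : Fin 4) (α β : ℕ) : Prop :=
  ([i, u, v, w].Nodup ∧ code (tr k i w) = combCode α β (code (tr k i u)) (code (tr k i v))) ∧
    ∀ x < 16, ∀ y < 16, SameRelations (code (tr k i u)) (code (tr k i v)) x y →
      1 + 2 ^ x + 2 ^ y + 2 ^ combCode α β x y ∈ (ucTable k i).map mask

instance (k : Fin 10) (i u v w : Fin 4) (α β : ℕ) : Decidable (IsFrame k i u v w α β) :=
  inferInstanceAs (Decidable ((_ ∧ _) ∧ _))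

/-- The computational half of `UCClass ⊆ ucTable`: for each set only the 256 pairs of possible
images of two labels have to be searched. -/
theorem exists_isFrame : ∀ (k : Fin 10) (i : Fin 4), ∃ u v w : Fin 4, ∃ α < 4, ∃ β < 4,
    IsFrame k i u v w α β := by
  decide +kernel

theorem uTable_nodup_mask : ∀ k, ((uTable k).map mask).Nodup := by
  decide +kernel

theorem ucTable_nodup_mask : ∀ k i, ((ucTable k i).map mask).Nodup := by
  decide +kernel

theorem rep_not_mem_uTable : ∀ k l, k ≠ l →
    ∑ j, 2 ^ code (rep l j) ∉ (uTable k).map mask := by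
  decide +kernel

end Checks

/-! ### U-classes in terms of UC-classes -/

section Classes

variable {d : ℕ} [NeZero d] {ι : Type*}

theorem zero_mem_of_mem_ucClass {M : ι → Mat d} (hM : ∀ i, M i ∈ unitaryGroup (ZMod d) ℂ) {i : ι}
    {N : Finset (ZMod d × ZMod d)} (h : N ∈ UCClass (rightDiv M i)) : (0, 0) ∈ N := by
  obtain ⟨L, hL, σ, h⟩ := h
  have h1 := h (σ.symm i)
  rw [Equiv.apply_symm_apply, rightDiv, mul_conjTranspose_of_mem (hM i), Matrix.mul_one,
    mul_conjTranspose_of_mem hL, ← gpm_zero] at h1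
  have h2 : ((σ.symm i : N) : ZMod d × ZMod d) = (0, 0) := gpm_injective_phaseEq h1
  rw [← h2]
  exact (σ.symm i).2

/-- The element `A` sent to the identity satisfies `L * A * R ≈ 1`, which solves to `R ≈ Aᴴ * Lᴴ`;
then `L * M j * R` is the conjugate of `M j * Aᴴ` by `L`. Conversely `R = (M i)ᴴ * Lᴴ` is unitary.
-/
theorem uClass_eq_iUnion {M : ι → Mat d} (hM : ∀ i, M i ∈ unitaryGroup (ZMod d) ℂ) :
    UClass M = ⋃ i, UCClass (rightDiv M i) := by
  ext N
  rw [Set.mem_iUnion]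
  constructor
  · rintro ⟨h0, L, hL, R, hR, σ, h⟩
    refine ⟨σ ⟨_, h0⟩, L, hL, σ, fun j => (h j).trans ?_⟩
    set A := M (σ ⟨_, h0⟩) with hA
    have h1 : PhaseEq (1 : Mat d) (L * A * R) := by
      rw [← gpm_zero]
      exact h ⟨_, h0⟩
    have h2 := (PhaseEq.refl (Aᴴ * Lᴴ)).mul h1
    have h3 : Aᴴ * Lᴴ * (L * A * R) = R := by
      calc Aᴴ * Lᴴ * (L * A * R) = Aᴴ * (Lᴴ * L) * A * R := by simp only [Matrix.mul_assoc]
        _ = R := by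
          rw [conjTranspose_mul_of_mem hL, Matrix.mul_one, conjTranspose_mul_of_mem (hM _),
            Matrix.one_mul]
    rw [h3, Matrix.mul_one] at h2
    have h4 := (PhaseEq.refl (L * M (σ j))).mul h2.symm
    simpa only [rightDiv, Matrix.mul_assoc] using h4
  · rintro ⟨i, h⟩
    refine ⟨zero_mem_of_mem_ucClass hM h, ?_⟩
    obtain ⟨L, hL, σ, h⟩ := h
    refine ⟨L, hL, (M i)ᴴ * Lᴴ, mul_mem (conjTranspose_mem (hM i)) (conjTranspose_mem hL), σ,
      fun j => ?_⟩
    simpa only [rightDiv, Matrix.mul_assoc] using h j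

/-- Translating all labels gives a U-equivalent set. -/
theorem uEquiv_image_sub (S : Finset (ZMod d × ZMod d)) (p : ZMod d × ZMod d) :
    UEquiv (gpmSet S) (gpmSet (S.image (· - p))) := by
  have hinj : Function.Injective (· - p) := sub_left_injective
  let τ : S ≃ S.image (· - p) := Equiv.ofBijective
    (fun x => ⟨x.1 - p, Finset.mem_image_of_mem _ x.2⟩)
    ⟨fun x y h => Subtype.ext (hinj (congrArg Subtype.val h)), fun y => by
      obtain ⟨x, hx, hxy⟩ := Finset.mem_image.1 y.2
      exact ⟨⟨x, hx⟩, Subtype.ext hxy⟩⟩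
  refine ⟨1, one_mem _, (gpm p)ᴴ, conjTranspose_mem (gpm_mem p), τ.symm, fun y => ?_⟩
  obtain ⟨x, rfl⟩ := τ.surjective y
  rw [Equiv.symm_apply_apply, Matrix.one_mul]
  exact (gpm_mul_conjTranspose_phaseEq x.1 p).symm

end Classes

/-- An injective family indexes the set of its values. -/
theorem exists_equiv_image {ι β : Type*} [Fintype ι] [DecidableEq β] {q : ι → β} (hq : Function.Injective q) :
    ∃ σ : (Finset.univ.image q : Finset _) ≃ ι, ∀ x, q (σ x) = x.1 := by
  let τ : ι ≃ (Finset.univ.image q : Finset _) := Equiv.ofBijective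
    (fun j => ⟨q j, Finset.mem_image_of_mem _ (Finset.mem_univ j)⟩)
    ⟨fun x y h => hq (congrArg Subtype.val h), fun y => by
      obtain ⟨x, _, hxy⟩ := Finset.mem_image.1 y.2
      exact ⟨x, Subtype.ext hxy⟩⟩
  exact ⟨τ.symm, fun x => congrArg Subtype.val (τ.apply_symm_apply x)⟩

/-! ### The UC-classes and U-classes of the ten representatives -/

theorem rep_injective (k : Fin 10) : Function.Injective (rep k) := by
  have h : ∀ k i j, rep k i = rep k j → i = j := by decide +kernel
  exact fun i j => h k i j

theorem tr_injective (k : Fin 10) (i : Fin 4) : Function.Injective (tr k i) := fun _ _ h =>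
  rep_injective k (sub_left_injective h)

theorem repGPM_mem (k : Fin 10) (j : Fin 4) : repGPM k j ∈ unitaryGroup (ZMod 4) ℂ := gpm_mem _

theorem rightDiv_repGPM_phaseEq (k : Fin 10) (i j : Fin 4) :
    PhaseEq (rightDiv (repGPM k) i j) (gpm (tr k i j)) := gpm_mul_conjTranspose_phaseEq _ _

theorem mem_of_mask_mem {N : Finset Label} {l : List (Finset Label)} (h : mask N ∈ l.map mask) :
    N ∈ l := (List.mem_map_of_injective mask_injective).1 h

theorem mem_ucClass_of_mem_ucTable {k : Fin 10} {i : Fin 4} {N : Finset Label}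
    (h : N ∈ ucTable k i) : N ∈ UCClass (rightDiv (repGPM k) i) := by
  obtain ⟨a, -, b, -, c, -, h⟩ :=
    exists_word_of_mem_ucTable k i (mask N) (List.mem_map_of_mem h)
  have hw := isClifford_word a b c
  have hinj : Function.Injective fun j => word a b c (tr k i j) :=
    hw.injective.comp (tr_injective k i)
  have hN : N = Finset.univ.image fun j => word a b c (tr k i j) := by
    apply mask_injective
    rw [mask_image hinj, h]
    simp only [code_word]
  obtain ⟨σ, hσ⟩ := exists_equiv_image hinj
  obtain ⟨U, hU, hw⟩ := hw
  rw [hN]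
  refine ⟨U, hU, σ, fun x => ?_⟩
  rw [gpmSet, ← hσ x]
  exact (hw _).trans (((PhaseEq.refl U).mul (rightDiv_repGPM_phaseEq k i (σ x)).symm).mul
    (PhaseEq.refl Uᴴ))

theorem sum_of_nodup {f : Fin 4 → ℕ} {i u v w : Fin 4} (h : [i, u, v, w].Nodup) :
    ∑ j, f j = f i + f u + f v + f w := by
  have h1 : [i, u, v, w].toFinset = Finset.univ := by
    apply Finset.eq_univ_of_card
    rw [List.toFinset_card_of_nodup h]
    rfl
  rw [← h1, List.sum_toFinset _ h]
  simp [add_assoc]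

theorem ConjTo.sameRelations {U : Mat 4} (hU : U ∈ unitaryGroup (ZMod 4) ℂ) {p p' q q' : Label}
    (h : ConjTo U p q) (h' : ConjTo U p' q') :
    SameRelations (code p) (code p') (code q) (code q') := by
  refine ⟨by rw [← symp_val, ← symp_val, h.symp_eq hU h'], fun a _ b _ => ?_⟩
  have h0 : ∀ p : Label, code p = 0 ↔ p = 0 := fun p => code_injective.eq_iff' rfl
  rw [← code_comb, ← code_comb, h0, h0]
  exact ((h.smul hU a).add hU (h'.smul hU b)).eq_zero_iff hU

/-- Nothing is known about `L` beyond its effect on the four given matrices, so only invariants of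
pairs of labels are used. -/
theorem mem_ucTable_of_mem_ucClass {k : Fin 10} {i : Fin 4} {N : Finset Label}
    (h : N ∈ UCClass (rightDiv (repGPM k) i)) : N ∈ ucTable k i := by
  obtain ⟨L, hL, σ, h⟩ := h
  set q : Fin 4 → Label := fun j => (σ.symm j : N) with hq
  have hqinj : Function.Injective q := Subtype.val_injective.comp σ.symm.injective
  have hN : N = Finset.univ.image q := by
    ext x
    simp only [hq, Finset.mem_image, Finset.mem_univ, true_and]
    exact ⟨fun hx => ⟨σ ⟨x, hx⟩, by simp⟩, by rintro ⟨j, rfl⟩; exact (σ.symm j).2⟩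
  have hc : ∀ j, ConjTo L (tr k i j) (q j) := by
    intro j
    have h1 := h (σ.symm j)
    rw [Equiv.apply_symm_apply] at h1
    exact h1.trans (((PhaseEq.refl L).mul (rightDiv_repGPM_phaseEq k i j)).mul (PhaseEq.refl Lᴴ))
  -- The `i`-th member of `M Mᵢ†` is the identity, and conjugation fixes it.
  have hi : q i = 0 := ((hc i).eq_zero_iff hL).1 (sub_self _)
  obtain ⟨u, v, w, α, -, β, -, ⟨hnd, hw⟩, hall⟩ := exists_isFrame k i
  rw [← code_comb] at hw
  have hqw : q w = (α : ZMod 4) • q u + (β : ZMod 4) • q v := by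
    have h1 := hc w
    rw [code_injective hw] at h1
    exact h1.right_unique (((hc u).smul hL α).add hL ((hc v).smul hL β))
  -- The images of the two frame labels form an admissible pair; `hqw` says that the fourth label of
  -- `N` is the same combination of them.
  have h1 := hall _ (code_lt (q u)) _ (code_lt (q v)) ((hc u).sameRelations hL (hc v))
  apply mem_of_mask_mem
  rw [hN, mask_image hqinj, sum_of_nodup hnd, hqw, code_comb, hi]
  -- The summand 1 in the frame condition is `2 ^ 0`, the bit of the zero label.
  exact h1

theorem ucClass_eq (k : Fin 10) (i : Fin 4) :
    UCClass (rightDiv (repGPM k) i) = {N | N ∈ ucTable k i} :=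
  Set.ext fun _ => ⟨mem_ucTable_of_mem_ucClass, mem_ucClass_of_mem_ucTable⟩

theorem mem_uTable_iff (k : Fin 10) (N : Finset Label) :
    N ∈ uTable k ↔ ∃ i, N ∈ ucTable k i := by
  rw [Fin.exists_fin_succ, Fin.exists_fin_succ, Fin.exists_fin_succ, Fin.exists_fin_succ]
  fin_cases k <;> simp [uTable, ucTable] <;> tauto

theorem uClass_eq (k : Fin 10) : UClass (repGPM k) = {N | N ∈ uTable k} := by
  ext N
  simp only [uClass_eq_iUnion (repGPM_mem k), ucClass_eq, Set.mem_iUnion, Set.mem_ofPred_eq,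
    mem_uTable_iff]

/-! ### Sizes, inequivalence and completeness -/

theorem ncard_setOf_mem {α : Type*} {l : List α} (h : l.Nodup) : {x | x ∈ l}.ncard = l.length := by
  classical
  rw [← List.coe_toFinset, Set.ncard_coe_finset, List.toFinset_card_of_nodup h]

theorem uTable_nodup (k : Fin 10) : (uTable k).Nodup := (uTable_nodup_mask k).of_map _

theorem ucTable_nodup (k : Fin 10) (i : Fin 4) : (ucTable k i).Nodup :=
  (ucTable_nodup_mask k i).of_map _

theorem uTable_length : ∀ k, (uTable k).length = classSize k := by decide +kernel

theorem ucTable_length : ∀ k i, (ucTable k i).length = ucSize k i := by decide +kernel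

/-- The label set of `rep l` is standard, so an equivalence would put it into the list of `k`, which
the finite check excludes. -/
theorem eq_of_uEquiv_repGPM {k l : Fin 10} (h : UEquiv (repGPM k) (repGPM l)) : k = l := by
  by_contra hkl
  obtain ⟨σ, hσ⟩ := exists_equiv_image (rep_injective l)
  have h1 : UEquiv (repGPM l) (gpmSet (Finset.univ.image (rep l))) :=
    UEquiv.of_phaseEq σ fun x => by
      rw [gpmSet, repGPM, hσ]
      exact PhaseEq.refl _
  have h0 : (0, 0) ∈ Finset.univ.image (rep l) := by
    have : ∀ l, rep l 0 = (0, 0) := by decide +kernel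
    exact Finset.mem_image.2 ⟨0, Finset.mem_univ _, this l⟩
  have h2 : Finset.univ.image (rep l) ∈ UClass (repGPM k) := ⟨h0, h.trans h1⟩
  rw [uClass_eq, Set.mem_ofPred_eq] at h2
  have h3 := List.mem_map_of_mem (f := mask) h2
  rw [mask_image (rep_injective l)] at h3
  exact rep_not_mem_uTable k l hkl h3

/-- Every standard set of four labels is listed, by counting. -/
theorem exists_mem_uTable {S : Finset Label} (h0 : (0, 0) ∈ S) (hS : S.card = 4) :
    ∃ k, S ∈ uTable k := by
  set A : Finset (Finset Label) :=
    ((Finset.univ.erase (0, 0)).powersetCard 3).image (insert (0, 0)) with hA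
  have hmem : ∀ T : Finset Label, (0, 0) ∈ T → T.card = 4 → T ∈ A := fun T hT hc =>
    Finset.mem_image.2 ⟨T.erase (0, 0), Finset.mem_powersetCard.2
      ⟨Finset.erase_subset_erase _ (Finset.subset_univ T), by rw [Finset.card_erase_of_mem hT, hc]⟩,
      Finset.insert_erase hT⟩
  -- A standard set is a choice of 3 of the 15 nonzero labels, and C(15, 3) = 455.
  have hAcard : A.card ≤ 455 := by
    refine Finset.card_image_le.trans ?_
    rw [Finset.card_powersetCard, Finset.card_erase_of_mem (Finset.mem_univ _), Finset.card_univ,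
      Fintype.card_prod, ZMod.card]
    decide
  set B : Finset (Finset Label) := Finset.univ.biUnion fun k => (uTable k).toFinset with hB
  have hmemU : ∀ {k T}, T ∈ uTable k → T ∈ UClass (repGPM k) := fun {k T} hT => by
    rw [uClass_eq]
    exact hT
  have hBA : B ⊆ A := by
    intro T hT
    obtain ⟨k, -, hk⟩ := Finset.mem_biUnion.1 hT
    obtain ⟨hT0, L, -, R, -, σ, -⟩ := hmemU (List.mem_toFinset.1 hk)
    exact hmem T hT0 (by simpa using Fintype.card_congr σ)
  have hBcard : B.card = 455 := by
    rw [hB, Finset.card_biUnion]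
    · simp only [List.toFinset_card_of_nodup (uTable_nodup _), uTable_length]
      decide
    -- A common member of two lists would make their representatives U-equivalent.
    · intro k _ l _ hkl
      rw [Function.onFun, Finset.disjoint_left]
      intro T hk hl
      exact hkl (eq_of_uEquiv_repGPM ((hmemU (List.mem_toFinset.1 hk)).2.trans
        (hmemU (List.mem_toFinset.1 hl)).2.symm))
  have hSB : S ∈ B := by
    rw [Finset.eq_of_subset_of_card_le hBA (by rw [hBcard]; exact hAcard)]
    exact hmem S h0 hS
  obtain ⟨k, -, hk⟩ := Finset.mem_biUnion.1 hSB
  exact ⟨k, List.mem_toFinset.1 hk⟩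

/-- Subtracting one of its own labels makes `S` standard without leaving its U-equivalence class. -/
theorem exists_uEquiv_gpmSet {S : Finset Label} (hS : S.card = 4) :
    ∃ k, UEquiv (repGPM k) (gpmSet S) := by
  obtain ⟨p, hp⟩ : S.Nonempty := Finset.card_pos.1 (by omega)
  have h0 : (0, 0) ∈ S.image (· - p) := Finset.mem_image.2 ⟨p, hp, sub_self p⟩
  obtain ⟨k, hk⟩ := exists_mem_uTable h0
    (by rw [Finset.card_image_of_injective _ sub_left_injective, hS])
  have h1 : S.image (· - p) ∈ UClass (repGPM k) := by
    rw [uClass_eq]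
    exact hk
  exact ⟨k, h1.2.trans (uEquiv_image_sub S p).symm⟩

theorem luEquiv_repGBS_iff {k l : Fin 10} :
    LUEquiv (repGBS k) (repGBS l) ↔ UEquiv (repGPM k) (repGPM l) := luEquiv_mes_iff

theorem luEquiv_gbsSet_iff {k : Fin 10} {S : Finset Label} :
    LUEquiv (repGBS k) (gbsSet S) ↔ UEquiv (repGPM k) (gpmSet S) := luEquiv_mes_iff

end GBS

theorem mainTheorem3 :
    -- the explicit lists of the UC-equivalence classes and their sizes
    (∀ (k : Fin 10) (i : Fin 4),
      GBS.UCClass (GBS.rightDiv (GBS.repGPM k) i) = {N | N ∈ GBS.ucTable k i} ∧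
      (GBS.UCClass (GBS.rightDiv (GBS.repGPM k) i)).ncard = GBS.ucSize k i) ∧
    -- the explicit lists of the U-equivalence classes of standard sets and their sizes
    (∀ k : Fin 10,
      GBS.UClass (GBS.repGPM k) = ⋃ i : Fin 4, GBS.UCClass (GBS.rightDiv (GBS.repGPM k) i) ∧
      GBS.UClass (GBS.repGPM k) = {N | N ∈ GBS.uTable k} ∧
      (GBS.UClass (GBS.repGPM k)).ncard = GBS.classSize k) ∧
    -- the representatives are pairwise inequivalent
    (∀ k l : Fin 10, k ≠ l →
      ¬ GBS.UEquiv (GBS.repGPM k) (GBS.repGPM l) ∧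
      ¬ GBS.LUEquiv (GBS.repGBS k) (GBS.repGBS l)) ∧
    -- every set of four generalized Bell states belongs to exactly one of the ten classes
    (∀ S : Finset (ZMod 4 × ZMod 4), S.card = 4 →
      ∃! k : Fin 10, GBS.LUEquiv (GBS.repGBS k) (GBS.gbsSet S)) := by
  refine ⟨fun k i => ⟨GBS.ucClass_eq k i, ?_⟩,
    fun k => ⟨GBS.uClass_eq_iUnion (GBS.repGPM_mem k), GBS.uClass_eq k, ?_⟩,
    fun k l hkl => ⟨fun h => hkl (GBS.eq_of_uEquiv_repGPM h),
      fun h => hkl (GBS.eq_of_uEquiv_repGPM (GBS.luEquiv_repGBS_iff.1 h))⟩, fun S hS => ?_⟩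
  · rw [GBS.ucClass_eq, GBS.ncard_setOf_mem (GBS.ucTable_nodup k i), GBS.ucTable_length]
  · rw [GBS.uClass_eq, GBS.ncard_setOf_mem (GBS.uTable_nodup k), GBS.uTable_length]
  · obtain ⟨k, hk⟩ := GBS.exists_uEquiv_gpmSet hS
    refine ⟨k, GBS.luEquiv_gbsSet_iff.2 hk, fun l hl => ?_⟩
    exact GBS.eq_of_uEquiv_repGPM ((GBS.luEquiv_gbsSet_iff.1 hl).trans hk.symm)
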